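/- For every integer $m\ge 1$ let $K=\mathbb{Q}(\zeta_m)$ with ring of integers $\mathcal{O}_K$, let $\phi(m)=[K:\mathbb{Q}]$, let $\mathfrak{P}=\mathfrak{P}_m$ be a prime ideal of $\mathcal{O}_K$ lying over a prime number $p=p_m$ with $p\nmid m$, and let $F=\mathcal{O}_K/\mathfrak{P}$, a finite field with $q_m$ elements. Let $K_{\mathbb{R}}=K\otimes_{\mathbb{Q}}\mathbb{R}$ be the Euclidean space of dimension $\phi(m)$ with the scalar product induced by the trace form, $\langle x,y\rangle=\mathrm{tr}_{K/\mathbb{Q}}(x\overline{y})$ for $x,y\in K$, and let $E=K_{\mathbb{R}}^2$ be the orthogonal direct sum of two copies of it, a Euclidean space of dimension $2\phi(m)$. Let $\pi:\mathcal{O}_K^2\to F^2$ be reduction modulo $\mathfrak{P}$, and let $$\mathcal{L}_m=\{\pi^{-1}(C) : C \text{ an } F\text{-line of } F^2\},$$ where $\pi^{-1}(C)\subset\mathcal{O}_K^2$ is regarded as a subset of $E$ through the natural embedding $K\to K_{\mathbb{R}}$. For a lattice $\Lambda$ in a Euclidean space of dimension $n$, let $\mu_\Lambda=\min\{\|x\|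 : x\in\Lambda\setminus\{0\}\}$, let $\mathrm{Vol}(\Lambda)$ be the volume of a fundamental region of $\Lambda$, and let $$\Delta(\Lambda)=\frac{\mathrm{Vol}(B(\mu_\Lambda))}{2^n\,\mathrm{Vol}(\Lambda)}$$ be its packing density, where $B(r)$ is the closed ball of radius $r$. **Theorem.** Let $0<\varepsilon<1$. If $\phi(m)^2\,m=o\big(q_m^{1/\phi(m)}\big)$ as $m\to\infty$, then for all sufficiently large $m$ the set $\mathcal{L}_m$ consists of exactly $q_m+1$ lattices of $E\cong\mathbb{R}^{2\phi(m)}$ and contains a lattice $\Lambda$ satisfying $$\Delta(\Lambda)>\frac{(1-\varepsilon)\,m}{2^{2\phi(m)}}.$$ -/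

import Mathlib

open NumberField Module MeasureTheory Filter Asymptotics

noncomputable section

namespace CyclotomicLattices

section Lattices

variable {E : Type*} [NormedAddCommGroup E] [InnerProductSpace ℝ E] [FiniteDimensional ℝ E]
  [MeasurableSpace E] [BorelSpace E]

/-- A lattice of a Euclidean space: a discrete `ℤ`-submodule of full rank. -/
def IsLattice (Λ : Submodule ℤ E) : Prop :=
  ∃ _ : DiscreteTopology Λ, IsZLattice ℝ Λ

/-- The minimum of a lattice: the smallest norm of its nonzero vectors. -/
def minimum (Λ : Submodule ℤ E) : ℝ :=
  sInf {r : ℝ | ∃ x ∈ Λ, x ≠ 0 ∧ r = ‖x‖}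

/-- The density `Vol(B(μ)) / (2 ^ n Vol(Λ))` of the sphere packing by balls of radius `μ / 2`
centred at the points of `Λ`, where `μ` is the minimum of `Λ`, `n` is the dimension of `E`, and
`Vol(Λ)` is the volume of a fundamental region of `Λ`. -/
def density (Λ : Submodule ℤ E) : ℝ :=
  (volume : Measure E).real (Metric.closedBall 0 (minimum Λ)) /
    (2 ^ finrank ℝ E * ZLattice.covolume Λ (volume : Measure E))

end Lattices

section NumberFields

variable (K : Type*) [Field K] [NumberField K]

/-- The canonical embedding `x ↦ (σ x)_σ` of a number field into the Hermitian space indexed by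
its complex embeddings. -/
def hermitianEmbedding : K →+ PiLp 2 (fun _ : K →+* ℂ => ℂ) where
  toFun x := WithLp.toLp 2 (canonicalEmbedding K x)
  map_zero' := by simp
  map_add' x y := by simp

/-- The Euclidean space `K ⊗ ℝ`, realized as the real span of the image of `K` in the Hermitian
space indexed by the complex embeddings of `K`. The scalar product it inherits is
`⟨x, y⟩ = ∑ σ, σ x * conj (σ y)` on the elements of `K`, which is the trace form `tr (x * conj y)`
when `K` is a cyclotomic field. -/
def EuclideanK : Type _ :=
  Submodule.span ℝ (Set.range (hermitianEmbedding K))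

instance : NormedAddCommGroup (EuclideanK K) :=
  inferInstanceAs (NormedAddCommGroup (Submodule.span ℝ (Set.range (hermitianEmbedding K))))

instance : InnerProductSpace ℝ (EuclideanK K) :=
  inferInstanceAs (InnerProductSpace ℝ (Submodule.span ℝ (Set.range (hermitianEmbedding K))))

instance : FiniteDimensional ℝ (EuclideanK K) :=
  inferInstanceAs (FiniteDimensional ℝ (Submodule.span ℝ (Set.range (hermitianEmbedding K))))

instance : MeasurableSpace (EuclideanK K) := borel _

instance : BorelSpace (EuclideanK K) := ⟨rfl⟩

instance : SecondCountableTopology (EuclideanK K) := by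
  have : ProperSpace (EuclideanK K) := FiniteDimensional.proper ℝ _
  infer_instance

/-- The natural embedding of `K` into `K ⊗ ℝ`. -/
def embK : K →+ EuclideanK K where
  toFun x := ⟨hermitianEmbedding K x, Submodule.subset_span (Set.mem_range_self x)⟩
  map_zero' := Subtype.ext (map_zero (hermitianEmbedding K))
  map_add' x y := Subtype.ext (map_add (hermitianEmbedding K) x y)

/-- The Euclidean space `(K ⊗ ℝ) ^ s`, orthogonal direct sum of `s` copies of `K ⊗ ℝ`. -/
abbrev Ambient (s : ℕ) : Type _ := PiLp 2 (fun _ : Fin s => EuclideanK K)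

/-- The embedding of `(𝓞 K) ^ s` into `(K ⊗ ℝ) ^ s`; its image is the lattice `Λ₀`. -/
def embIntegers (s : ℕ) : (Fin s → 𝓞 K) →+ Ambient K s where
  toFun x := WithLp.toLp 2 (fun i => embK K (x i : K))
  map_zero' := by ext i : 1; simp
  map_add' x y := by ext i : 1; simp

variable {K}

/-- The canonical surjection `π : (𝓞 K) ^ s → (𝓞 K ⧸ 𝔓) ^ s`, reduction modulo `𝔓`. -/
def reduction (𝔓 : Ideal (𝓞 K)) (s : ℕ) : (Fin s → 𝓞 K) →+ (Fin s → 𝓞 K ⧸ 𝔓) where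
  toFun x := fun i => Ideal.Quotient.mk 𝔓 (x i)
  map_zero' := by ext i; simp
  map_add' x y := by ext i; simp

/-- The lattice `Λ_C = π⁻¹(C)` obtained from a code `C` by Construction A. -/
def codeLattice (𝔓 : Ideal (𝓞 K)) {s : ℕ} (C : Submodule (𝓞 K ⧸ 𝔓) (Fin s → 𝓞 K ⧸ 𝔓)) :
    Submodule ℤ (Ambient K s) :=
  AddSubgroup.toIntSubmodule
    ((C.toAddSubgroup.comap (reduction 𝔓 s)).map (embIntegers K s))

/-- The family of the lattices `Λ_C`, for `C` running over the lines of `(𝓞 K ⧸ 𝔓) ^ 2`. -/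
def lineFamily (𝔓 : Ideal (𝓞 K)) : Set (Submodule ℤ (Ambient K 2)) :=
  {Λ | ∃ C : Submodule (𝓞 K ⧸ 𝔓) (Fin 2 → 𝓞 K ⧸ 𝔓),
    finrank (𝓞 K ⧸ 𝔓) C = 1 ∧ Λ = codeLattice 𝔓 C}

end NumberFields

end CyclotomicLattices

end

/-!
Two distinct lines `C` meet only in `0`, so the lattices `Λ_C` meet only in vectors reducing to `0`
modulo `𝔓`, and those are long: by the inequality between the arithmetic and geometric means,
`‖x‖ ^ 2 ≥ φ(m) N(𝔓) ^ (2 / φ(m))` for a nonzero such `x`. If every `Λ_C` had a nonzero vector of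
length at most `r`, with `r` below this bound, then the multiples of these vectors by the roots of
unity, which act by isometries and number at least `m`, would be `(q + 1) m` distinct vectors of
length at most `r` in `Λ₀ = (𝓞 K) ^ 2`. Rounding the coordinates in the basis of the powers of `ζ_m`
shows that the covering radius of `Λ₀` is at most `φ(m)`, so that this number is at most
`Vol(B(r + φ(m))) / Vol(Λ₀)`. Hence some `Λ_C` has minimum at least `r` as soon as
`Vol(B(r + φ(m))) < (q + 1) m Vol(Λ₀)`. The growth hypothesis on `q` makes `φ(m) ^ 2 / r` small, so
that by Bernoulli's inequality replacing `r + φ(m)` by `r` costs a factor `1 - ε` at most.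
-/

namespace CyclotomicLattices

section Rounding

variable {E : Type*} [NormedAddCommGroup E] [InnerProductSpace ℝ E]

theorem exists_int_norm_add_sub_smul_sq_le (w v : E) (c : ℝ) :
    ∃ k : ℤ, ‖w + (c - k) • v‖ ^ 2 ≤ ‖w‖ ^ 2 + ‖v‖ ^ 2 / 4 := by
  set t := Int.fract c
  have expand (a : ℝ) : ‖w + a • v‖ ^ 2 = ‖w‖ ^ 2 + 2 * a * inner ℝ w v + a ^ 2 * ‖v‖ ^ 2 := by
    rw [norm_add_sq_real, real_inner_smul_right, norm_smul, mul_pow, Real.norm_eq_abs, sq_abs]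
    ring
  -- Rounding `c` down with probability `1 - t` and up with probability `t` has mean zero error.
  have average : (1 - t) * ‖w + t • v‖ ^ 2 + t * ‖w + (t - 1) • v‖ ^ 2 =
      ‖w‖ ^ 2 + t * (1 - t) * ‖v‖ ^ 2 := by
    rw [expand, expand]
    ring
  have variance_le : t * (1 - t) * ‖v‖ ^ 2 ≤ ‖v‖ ^ 2 / 4 := by
    nlinarith [mul_nonneg (sq_nonneg (t - 1 / 2)) (sq_nonneg ‖v‖)]
  have floor_eq : c - (⌊c⌋ : ℤ) = t := rfl
  have floor_add_one_eq : c - (⌊c⌋ + 1 : ℤ) = t - 1 := by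
    push_cast
    rw [← floor_eq]
    ring
  by_contra! h
  have down := h ⌊c⌋
  have up := h (⌊c⌋ + 1)
  rw [floor_eq] at down
  rw [floor_add_one_eq] at up
  nlinarith [Int.fract_nonneg c, Int.fract_lt_one c]

theorem exists_int_norm_sq_sum_le {ι : Type*} (s : Finset ι) (v : ι → E) (c : ι → ℝ) :
    ∃ z : ι → ℤ, ‖∑ i ∈ s, (c i - z i) • v i‖ ^ 2 ≤ (∑ i ∈ s, ‖v i‖ ^ 2) / 4 := by
  classical
  induction s using Finset.induction_on with
  | empty => exact ⟨0, by simp⟩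
  | insert a s ha ih =>
    obtain ⟨z, hz⟩ := ih
    obtain ⟨k, hk⟩ := exists_int_norm_add_sub_smul_sq_le (∑ i ∈ s, (c i - z i) • v i) (v a) (c a)
    refine ⟨Function.update z a k, ?_⟩
    have sum_update : ∑ i ∈ s, (c i - Function.update z a k i) • v i =
        ∑ i ∈ s, (c i - z i) • v i :=
      Finset.sum_congr rfl fun i hi => by
        rw [Function.update_of_ne (ne_of_mem_of_not_mem hi ha)]
    rw [Finset.sum_insert ha, Finset.sum_insert ha, sum_update, Function.update_self, add_comm]
    linarith

theorem exists_mem_span_int_norm_sub_sq_le {ι : Type*} [Fintype ι] {v : ι → E}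
    (hv : Submodule.span ℝ (Set.range v) = ⊤) (y : E) :
    ∃ x ∈ Submodule.span ℤ (Set.range v), ‖y - x‖ ^ 2 ≤ (∑ i, ‖v i‖ ^ 2) / 4 := by
  have hy : y ∈ Submodule.span ℝ (Set.range v) := hv ▸ Submodule.mem_top
  obtain ⟨c, rfl⟩ := (Submodule.mem_span_range_iff_exists_fun ℝ).1 hy
  obtain ⟨z, hz⟩ := exists_int_norm_sq_sum_le Finset.univ v c
  refine ⟨∑ i, z i • v i, Submodule.sum_mem _ fun i _ =>
    Submodule.smul_mem _ _ (Submodule.subset_span (Set.mem_range_self i)), ?_⟩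
  rw [← Finset.sum_sub_distrib]
  simpa only [sub_smul, Int.cast_smul_eq_zsmul] using hz

end Rounding

theorem card_mul_measure_le_of_forall_exists_finset {G α : Type*} [AddGroup G] [Countable G]
    [AddAction G α] [MeasurableSpace α] {μ : Measure α} [MeasurableConstVAdd G α]
    [VAddInvariantMeasure G α μ] {F B : Set α} (hF : IsAddFundamentalDomain G F μ)
    (hB : MeasurableSet B) {k : ℕ}
    (h : ∀ x, ∃ S : Finset G, k ≤ S.card ∧ ∀ g ∈ S, g +ᵥ x ∈ B) : k * μ F ≤ μ B := by
  have measurable_translate (g : G) : Measurable fun x => B.indicator (1 : α → ENNReal) (g +ᵥ x) :=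
    (measurable_one.indicator hB).comp (measurable_const_vadd g)
  have le_orbit_count (x : α) : (k : ENNReal) ≤ ∑' g : G, B.indicator 1 (g +ᵥ x) := by
    obtain ⟨S, hkS, hS⟩ := h x
    calc (k : ENNReal) ≤ S.card := by exact_mod_cast hkS
      _ = ∑ g ∈ S, B.indicator 1 (g +ᵥ x) := by
        rw [Finset.sum_congr rfl fun g hg => Set.indicator_of_mem (hS g hg) 1]
        simp
      _ ≤ ∑' g : G, B.indicator 1 (g +ᵥ x) := ENNReal.sum_le_tsum S
  calc k * μ F = ∫⁻ _ in F, k ∂μ := (setLIntegral_const F _).symm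
    _ ≤ ∫⁻ x in F, ∑' g : G, B.indicator 1 (g +ᵥ x) ∂μ := lintegral_mono le_orbit_count
    _ = μ B := by
      rw [lintegral_tsum fun g => (measurable_translate g).aemeasurable,
        ← hF.lintegral_eq_tsum'', lintegral_indicator_one hB]

section Lattices

section Normed

variable {E : Type*} [NormedAddCommGroup E] [NormedSpace ℝ E] [FiniteDimensional ℝ E]
  [MeasurableSpace E] [BorelSpace E] (μ : Measure E) [μ.IsAddHaarMeasure]
  (L : Submodule ℤ E) [DiscreteTopology L] [IsZLattice ℝ L]

theorem exists_isAddFundamentalDomain :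
    ∃ F : Set E, IsAddFundamentalDomain L F μ ∧ μ F = ENNReal.ofReal (ZLattice.covolume L μ) := by
  have := ZLattice.module_free ℝ L
  have := ZLattice.module_finite ℝ L
  have hF := ZLattice.isAddFundamentalDomain (Free.chooseBasis ℤ L) μ
  refine ⟨_, hF, ?_⟩
  rw [ZLattice.covolume_eq_measure_fundamentalDomain L μ hF,
    ofReal_measureReal (ZSpan.fundamentalDomain_isBounded _).measure_lt_top.ne]

theorem card_mul_covolume_le {r ρ : ℝ} (hρ : ∀ y, ∃ x ∈ L, ‖y - x‖ ≤ ρ) (S : Finset L)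
    (hS : ∀ x ∈ S, ‖(x : E)‖ ≤ r) :
    S.card * ZLattice.covolume L μ ≤ μ.real (Metric.closedBall 0 (r + ρ)) := by
  obtain ⟨F, hF, hμF⟩ := exists_isAddFundamentalDomain μ L
  have : VAddInvariantMeasure L E μ := inferInstanceAs (VAddInvariantMeasure L.toAddSubgroup E μ)
  have hle : S.card * μ F ≤ μ (Metric.closedBall 0 (r + ρ)) := by
    refine card_mul_measure_le_of_forall_exists_finset hF
      Metric.isClosed_closedBall.measurableSet fun x => ?_
    obtain ⟨y, hy, hxy⟩ := hρ x
    refine ⟨S.map (Equiv.subRight ⟨y, hy⟩).toEmbedding, (Finset.card_map _).ge, fun g hg => ?_⟩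
    obtain ⟨s, hs, rfl⟩ := Finset.mem_map.1 hg
    have vadd_eq : (s - ⟨y, hy⟩ : L) +ᵥ x = (s : E) + (x - y) := by
      rw [Submodule.vadd_def, vadd_eq_add, AddSubgroupClass.coe_sub]
      abel
    rw [mem_closedBall_zero_iff, Equiv.coe_toEmbedding, Equiv.subRight_apply, vadd_eq]
    exact (norm_add_le _ _).trans (add_le_add (hS s hs) hxy)
  rw [hμF] at hle
  have := ENNReal.toReal_mono measure_closedBall_lt_top.ne hle
  rwa [ENNReal.toReal_mul, ENNReal.toReal_natCast,
    ENNReal.toReal_ofReal (ZLattice.covolume_pos L μ).le] at this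

theorem measure_ball_le_covolume_mul_two_pow {r : ℝ} (hr : ∀ x ∈ L, x ≠ 0 → r ≤ ‖x‖) :
    μ.real (Metric.ball 0 r) ≤ ZLattice.covolume L μ * 2 ^ finrank ℝ E := by
  obtain ⟨F, hF, hμF⟩ := exists_isAddFundamentalDomain μ L
  by_contra! hlt
  have hvol : μ F * 2 ^ finrank ℝ E < μ (Metric.ball (0 : E) r) := by
    rwa [hμF, ← ENNReal.toReal_lt_toReal (by finiteness) measure_ball_lt_top.ne,
      ENNReal.toReal_mul, ENNReal.toReal_ofReal (ZLattice.covolume_pos L μ).le, ENNReal.toReal_pow]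
  have : Countable L.toAddSubgroup := inferInstanceAs (Countable L)
  obtain ⟨x, hx0, hx⟩ := exists_ne_zero_mem_lattice_of_measure_mul_two_pow_lt_measure
    (L := L.toAddSubgroup) hF (fun x hx => by simpa using hx) (convex_ball 0 r) hvol
  exact (hr x x.2 (by simpa using hx0)).not_gt (mem_ball_zero_iff.1 hx)

end Normed

section Euclidean

variable {E : Type*} [NormedAddCommGroup E] [InnerProductSpace ℝ E]

theorem isLattice_of_le_of_smul_mem {L M : Submodule ℤ E} [DiscreteTopology L] [IsZLattice ℝ L]
    (hML : M ≤ L) {k : ℤ} (hk : k ≠ 0) (hM : ∀ x ∈ L, k • x ∈ M) : IsLattice M := by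
  have : DiscreteTopology M := DiscreteTopology.of_subset (s := (L : Set E)) ‹_› hML
  refine ⟨this, ⟨?_⟩⟩
  rw [eq_top_iff, ← IsZLattice.span_top (K := ℝ) (L := L), Submodule.span_le]
  intro x hx
  have hkx := Submodule.smul_mem _ (k : ℝ)⁻¹ (Submodule.subset_span (R := ℝ) (hM x hx))
  rwa [← Int.cast_smul_eq_zsmul ℝ, inv_smul_smul₀ (Int.cast_ne_zero.2 hk)] at hkx

theorem le_minimum [Nontrivial E] {Λ : Submodule ℤ E} [DiscreteTopology Λ] [IsZLattice ℝ Λ] {r : ℝ}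
    (hr : ∀ x ∈ Λ, x ≠ 0 → r ≤ ‖x‖) : r ≤ minimum Λ := by
  have hΛ : Λ ≠ ⊥ := by
    rintro rfl
    have := IsZLattice.span_top (K := ℝ) (L := (⊥ : Submodule ℤ E))
    simp at this
  obtain ⟨x, hx, hx0⟩ := Submodule.exists_mem_ne_zero_of_ne_bot hΛ
  refine le_csInf ⟨‖x‖, x, hx, hx0, rfl⟩ ?_
  rintro _ ⟨x, hx, hx0, rfl⟩
  exact hr x hx hx0

variable [FiniteDimensional ℝ E] [MeasurableSpace E] [BorelSpace E]

theorem le_density [Nontrivial E] {Λ : Submodule ℤ E} [DiscreteTopology Λ] [IsZLattice ℝ Λ] {r : ℝ}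
    (hr : ∀ x ∈ Λ, x ≠ 0 → r ≤ ‖x‖) :
    (volume : Measure E).real (Metric.closedBall 0 r) /
      (2 ^ finrank ℝ E * ZLattice.covolume Λ) ≤ density Λ := by
  have := ZLattice.covolume_pos Λ (volume : Measure E)
  rw [density]
  gcongr
  · exact measure_closedBall_lt_top.ne
  · exact le_minimum hr

end Euclidean

end Lattices

section Lines

variable {F V : Type*} [Field F] [AddCommGroup V] [Module F V]

theorem ncard_submodule_finrank_eq_one [Finite F] (hV : finrank F V = 2) :
    {C : Submodule F V | finrank F C = 1}.ncard = Nat.card F + 1 := by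
  rw [← Projectivization.card_of_finrank_two F V hV,
    Nat.card_congr (Projectivization.equivSubmodule F V)]
  rfl

theorem pairwiseDisjoint_submodule_finrank_eq_one :
    {C : Submodule F V | finrank F C = 1}.PairwiseDisjoint id := fun _ hC _ hD hne =>
  (Submodule.isAtom_iff_finrank_eq_one.2 hC).disjoint_of_ne
    (Submodule.isAtom_iff_finrank_eq_one.2 hD) hne

theorem index_toAddSubgroup [FiniteDimensional F V] (C : Submodule F V) :
    C.toAddSubgroup.index = Nat.card F ^ (finrank F V - finrank F C) := by
  rw [← Submodule.finrank_quotient, ← Module.natCard_eq_pow_finrank]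
  rfl

end Lines

theorem card_pow_mul_prod_le_sum_pow {ι : Type*} (s : Finset ι) {z : ι → ℝ}
    (hz : ∀ i ∈ s, 0 ≤ z i) : (s.card : ℝ) ^ s.card * ∏ i ∈ s, z i ≤ (∑ i ∈ s, z i) ^ s.card := by
  rcases s.eq_empty_or_nonempty with rfl | hs
  · simp
  have hcard : (0 : ℝ) < s.card := by exact_mod_cast hs.card_pos
  have am_gm := Real.geom_mean_le_arith_mean s (fun _ => 1) z (fun _ _ => zero_le_one)
    (by simpa using hcard) hz
  simp only [Real.rpow_one, one_mul, Finset.sum_const, nsmul_eq_mul, mul_one] at am_gm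
  calc (s.card : ℝ) ^ s.card * ∏ i ∈ s, z i
      = (s.card * (∏ i ∈ s, z i) ^ ((s.card : ℝ)⁻¹)) ^ s.card := by
        rw [mul_pow, Real.rpow_inv_natCast_pow (Finset.prod_nonneg hz) hs.card_ne_zero]
    _ ≤ (∑ i ∈ s, z i) ^ s.card := by
        have := Finset.prod_nonneg hz
        gcongr
        rwa [le_div_iff₀' hcard] at am_gm

section Embeddings

variable (K : Type*) [Field K] [NumberField K]

/-- The inclusion of `K ⊗ ℝ` into the Hermitian space indexed by the complex embeddings, through
which the scalar product of `K ⊗ ℝ` is computed. -/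
noncomputable def euclideanKIncl : EuclideanK K →ₗᵢ[ℝ] PiLp 2 (fun _ : K →+* ℂ => ℂ) :=
  (Submodule.span ℝ (Set.range (hermitianEmbedding K))).subtypeₗᵢ

@[simp]
theorem euclideanKIncl_embK (x : K) : euclideanKIncl K (embK K x) = hermitianEmbedding K x := rfl

variable {K}

theorem norm_embK_sq (x : K) : ‖embK K x‖ ^ 2 = ∑ σ : K →+* ℂ, ‖σ x‖ ^ 2 := by
  rw [← (euclideanKIncl K).norm_map, euclideanKIncl_embK, PiLp.norm_sq_eq_of_L2]
  rfl

theorem norm_embK_sq_of_pow_eq_one {ζ : K} {k : ℕ} (hk : k ≠ 0) (hζ : ζ ^ k = 1) :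
    ‖embK K ζ‖ ^ 2 = finrank ℚ K := by
  have norm_eq_one (σ : K →+* ℂ) : ‖σ ζ‖ = 1 :=
    Complex.norm_eq_one_of_pow_eq_one (by rw [← map_pow, hζ, map_one]) hk
  rw [norm_embK_sq]
  simp only [norm_eq_one, one_pow, Finset.sum_const, Finset.card_univ, Embeddings.card,
    nsmul_eq_mul, mul_one]

theorem norm_embIntegers_sq {s : ℕ} (x : Fin s → 𝓞 K) :
    ‖embIntegers K s x‖ ^ 2 = ∑ i, ‖embK K (x i)‖ ^ 2 := by
  rw [PiLp.norm_sq_eq_of_L2]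
  rfl

theorem norm_embK_mul_of_forall_norm_eq_one {u : K} (hu : ∀ σ : K →+* ℂ, ‖σ u‖ = 1) (x : K) :
    ‖embK K (u * x)‖ = ‖embK K x‖ := by
  rw [← sq_eq_sq₀ (norm_nonneg _) (norm_nonneg _), norm_embK_sq, norm_embK_sq]
  simp only [map_mul, norm_mul, hu, one_mul]

theorem norm_embIntegers_torsion_smul (u : Units.torsion K) {s : ℕ} (x : Fin s → 𝓞 K) :
    ‖embIntegers K s (((u : (𝓞 K)ˣ) : 𝓞 K) • x)‖ = ‖embIntegers K s x‖ := by
  have norm_eq_one (σ : K →+* ℂ) : ‖σ ((u : (𝓞 K)ˣ) : 𝓞 K)‖ = 1 :=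
    (Units.mem_torsion K).1 u.2 (InfinitePlace.mk σ)
  rw [← sq_eq_sq₀ (norm_nonneg _) (norm_nonneg _), norm_embIntegers_sq, norm_embIntegers_sq]
  simp only [Pi.smul_apply, smul_eq_mul, map_mul, norm_embK_mul_of_forall_norm_eq_one norm_eq_one]

theorem absNorm_le_abs_norm {I : Ideal (𝓞 K)} {x : 𝓞 K} (hx : x ∈ I) (hx0 : x ≠ 0) :
    (Ideal.absNorm I : ℝ) ≤ |(Algebra.norm ℚ (x : K) : ℝ)| := by
  have hdvd : Ideal.absNorm I ∣ (Algebra.norm ℤ x).natAbs := by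
    rw [← Ideal.absNorm_span_singleton]
    exact Ideal.absNorm_dvd_absNorm_of_le ((Ideal.span_singleton_le_iff_mem I).2 hx)
  have hle := Nat.le_of_dvd (Int.natAbs_pos.2 (Algebra.norm_ne_zero_iff.2 hx0)) hdvd
  calc (Ideal.absNorm I : ℝ) ≤ ((Algebra.norm ℤ x).natAbs : ℝ) := by exact_mod_cast hle
    _ = |(Algebra.norm ℚ (x : K) : ℝ)| := by
      rw [← Algebra.coe_norm_int, Nat.cast_natAbs, Rat.cast_intCast, Int.cast_abs]

theorem prod_norm_embeddings (x : K) :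
    ∏ σ : K →+* ℂ, ‖σ x‖ = |(Algebra.norm ℚ x : ℝ)| := by
  have h := congrArg norm (Algebra.norm_eq_prod_embeddings ℚ ℂ x)
  rw [norm_prod, eq_ratCast, Complex.norm_ratCast] at h
  rw [h]
  exact Fintype.prod_equiv (RingHom.equivRatAlgHom K ℂ) _ _ fun _ => rfl

theorem absNorm_sq_le_norm_embK_pow {I : Ideal (𝓞 K)} {x : 𝓞 K} (hx : x ∈ I) (hx0 : x ≠ 0) :
    (finrank ℚ K : ℝ) ^ finrank ℚ K * (Ideal.absNorm I : ℝ) ^ 2 ≤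
      (‖embK K x‖ ^ 2) ^ finrank ℚ K := by
  have am_gm := card_pow_mul_prod_le_sum_pow (Finset.univ : Finset (K →+* ℂ))
    (z := fun σ => ‖σ x‖ ^ 2) fun _ _ => sq_nonneg _
  rw [Finset.card_univ, Embeddings.card, Finset.prod_pow, prod_norm_embeddings,
    ← norm_embK_sq] at am_gm
  refine le_trans ?_ am_gm
  gcongr
  exact absNorm_le_abs_norm hx hx0

theorem absNorm_sq_le_norm_embIntegers_pow {I : Ideal (𝓞 K)} {s : ℕ} {x : Fin s → 𝓞 K}
    (hx : ∀ i, x i ∈ I) (hx0 : x ≠ 0) :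
    (finrank ℚ K : ℝ) ^ finrank ℚ K * (Ideal.absNorm I : ℝ) ^ 2 ≤
      (‖embIntegers K s x‖ ^ 2) ^ finrank ℚ K := by
  obtain ⟨i, hi⟩ := Function.ne_iff.1 hx0
  refine (absNorm_sq_le_norm_embK_pow (hx i) hi).trans ?_
  rw [norm_embIntegers_sq]
  gcongr
  exact Finset.single_le_sum (f := fun i => ‖embK K (x i)‖ ^ 2) (fun _ _ => sq_nonneg _)
    (Finset.mem_univ i)

theorem finrank_le_norm_embIntegers_sq {s : ℕ} {x : Fin s → 𝓞 K} (hx0 : x ≠ 0) :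
    (finrank ℚ K : ℝ) ≤ ‖embIntegers K s x‖ ^ 2 := by
  have h := absNorm_sq_le_norm_embIntegers_pow (I := ⊤) (x := x) (fun _ => Submodule.mem_top) hx0
  rw [Ideal.absNorm_top, Nat.cast_one, one_pow, mul_one] at h
  exact le_of_pow_le_pow_left₀ finrank_pos.ne' (sq_nonneg _) h

theorem embIntegers_injective (s : ℕ) : Function.Injective (embIntegers K s) := by
  refine (injective_iff_map_eq_zero _).2 fun x hx => ?_
  by_contra hx0
  have h := finrank_le_norm_embIntegers_sq hx0
  rw [hx, norm_zero, zero_pow two_ne_zero] at h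
  exact h.not_gt (by exact_mod_cast finrank_pos)

theorem span_range_embK : Submodule.span ℝ (Set.range (embK K)) = ⊤ := by
  have range_eq : Set.range (embK K) = Subtype.val ⁻¹' Set.range (hermitianEmbedding K) := by
    ext y
    exact exists_congr fun x => Subtype.ext_iff
  rw [range_eq]
  exact Submodule.span_span_coe_preimage

theorem span_range_embK_comp {ι : Type*} {v : ι → K} (hv : Submodule.span ℚ (Set.range v) = ⊤) :
    Submodule.span ℝ (Set.range fun i => embK K (v i)) = ⊤ := by
  rw [eq_top_iff, ← span_range_embK, Submodule.span_le]
  rintro _ ⟨x, rfl⟩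
  have hx : x ∈ Submodule.span ℚ (Set.range v) := hv ▸ Submodule.mem_top
  induction hx using Submodule.span_induction with
  | mem x hx =>
    obtain ⟨i, rfl⟩ := hx
    exact Submodule.subset_span ⟨i, rfl⟩
  | zero => exact (map_zero (embK K)).symm ▸ Submodule.zero_mem _
  | add x y _ _ hx hy => exact (map_add (embK K) x y).symm ▸ Submodule.add_mem _ hx hy
  | smul a x _ hx =>
    have map_smul := map_ratCast_smul (embK K) ℚ ℝ a x
    rw [Rat.cast_id] at map_smul
    exact map_smul ▸ Submodule.smul_mem _ _ hx

end Embeddings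

section IntLattice

variable (K : Type*) [Field K] [NumberField K] (s : ℕ)

/-- The lattice `Λ₀ = (𝓞 K) ^ s` of `(K ⊗ ℝ) ^ s`. -/
noncomputable def intLattice : Submodule ℤ (Ambient K s) :=
  AddSubgroup.toIntSubmodule (embIntegers K s).range

variable {K s}

theorem embIntegers_mem_intLattice (x : Fin s → 𝓞 K) : embIntegers K s x ∈ intLattice K s :=
  ⟨x, rfl⟩

theorem finrank_le_norm_sq_of_mem_intLattice {x : Ambient K s} (hx : x ∈ intLattice K s)
    (hx0 : x ≠ 0) : (finrank ℚ K : ℝ) ≤ ‖x‖ ^ 2 := by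
  obtain ⟨y, rfl⟩ := hx
  exact finrank_le_norm_embIntegers_sq fun h => hx0 (h ▸ map_zero _)

instance : DiscreteTopology (intLattice K s) := by
  refine discreteTopology_of_isOpen_singleton_zero ?_
  have : ({0} : Set (intLattice K s)) = Metric.ball 0 1 := by
    refine (Set.eq_singleton_iff_unique_mem.2 ⟨Metric.mem_ball_self one_pos, fun x hx => ?_⟩).symm
    by_contra hx0
    have hle := finrank_le_norm_sq_of_mem_intLattice x.2 (by simpa using hx0)
    have hlt : ‖(x : Ambient K s)‖ < 1 := mem_ball_zero_iff.1 hx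
    have hn : (1 : ℝ) ≤ finrank ℚ K := by exact_mod_cast finrank_pos (R := ℚ) (M := K)
    nlinarith [norm_nonneg (x : Ambient K s)]
  exact this ▸ Metric.isOpen_ball

theorem embIntegers_single (i : Fin s) (a : 𝓞 K) :
    embIntegers K s (Pi.single i a) = PiLp.single 2 i (embK K a) := by
  ext j : 1
  by_cases h : j = i
  · subst h
    simp [embIntegers]
  · simp [embIntegers, h]

theorem span_range_embIntegers_single {ι : Type*} {v : ι → 𝓞 K}
    (hv : Submodule.span ℚ (Set.range fun k => (v k : K)) = ⊤) :
    Submodule.span ℝ (Set.range fun j : Fin s × ι => embIntegers K s (Pi.single j.1 (v j.2))) =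
      ⊤ := by
  refine eq_top_iff.2 fun y _ => ?_
  have sum_single : y = ∑ i, PiLp.single 2 i (y i) := by
    ext j : 1
    simp
  rw [sum_single]
  refine Submodule.sum_mem _ fun i _ => ?_
  let singleₗ : EuclideanK K →ₗ[ℝ] Ambient K s :=
    (WithLp.linearEquiv 2 ℝ (Fin s → EuclideanK K)).symm.toLinearMap ∘ₗ
      LinearMap.single ℝ (fun _ => EuclideanK K) i
  suffices h : ⊤ ≤ (Submodule.span ℝ (Set.range fun j : Fin s × ι =>
    embIntegers K s (Pi.single j.1 (v j.2)))).comap singleₗ from h (Submodule.mem_top (x := y i))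
  rw [← span_range_embK_comp hv, Submodule.span_le]
  rintro _ ⟨k, rfl⟩
  exact Submodule.subset_span ⟨(i, k), embIntegers_single i (v k)⟩

instance : IsZLattice ℝ (intLattice K s) := by
  refine ⟨eq_top_iff.2 ?_⟩
  have hspan : Submodule.span ℚ (Set.range fun i => (RingOfIntegers.basis K i : K)) = ⊤ := by
    rw [← (integralBasis K).span_eq]
    exact congrArg _ (congrArg _ (funext fun i => (integralBasis_apply K i).symm))
  rw [← span_range_embIntegers_single hspan]
  exact Submodule.span_mono (Set.range_subset_iff.2 fun _ => embIntegers_mem_intLattice _)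

variable (K s) in
theorem finrank_ambient : finrank ℝ (Ambient K s) = s * finrank ℚ K := by
  let e : (Fin s → 𝓞 K) ≃+ intLattice K s :=
    (embIntegers K s).ofInjective (embIntegers_injective s)
  rw [← ZLattice.rank ℝ (intLattice K s), ← e.toIntLinearEquiv.finrank_eq,
    Module.finrank_pi_fintype, Finset.sum_const, Finset.card_fin, RingOfIntegers.rank, smul_eq_mul]

instance [NeZero s] : Nontrivial (Ambient K s) := by
  refine nontrivial_of_finrank_pos (R := ℝ) ?_
  rw [finrank_ambient]
  exact mul_pos (NeZero.pos s) finrank_pos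

theorem exists_mem_intLattice_norm_sub_sq_le {ι : Type*} [Fintype ι] {v : ι → 𝓞 K}
    (hv : Submodule.span ℚ (Set.range fun k => (v k : K)) = ⊤) (y : Ambient K s) :
    ∃ x ∈ intLattice K s, ‖y - x‖ ^ 2 ≤ s * (∑ k, ‖embK K (v k)‖ ^ 2) / 4 := by
  obtain ⟨x, hx, hxy⟩ :=
    exists_mem_span_int_norm_sub_sq_le (span_range_embIntegers_single hv) y
  refine ⟨x, Submodule.span_le.2 (Set.range_subset_iff.2 fun _ => embIntegers_mem_intLattice _) hx,
    hxy.trans_eq ?_⟩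
  simp only [embIntegers_single, PiLp.norm_single, Fintype.sum_prod_type, Finset.sum_const,
    Finset.card_univ, Fintype.card_fin, nsmul_eq_mul]

end IntLattice

section ConstructionA

variable {K : Type*} [Field K] {I : Ideal (𝓞 K)} {s : ℕ}

theorem reduction_surjective : Function.Surjective (reduction I s) :=
  Ideal.Quotient.mk_surjective.comp_left

theorem reduction_smul (a : 𝓞 K) (y : Fin s → 𝓞 K) :
    reduction I s (a • y) = Ideal.Quotient.mk I a • reduction I s y :=
  rfl

theorem reduction_eq_zero {y : Fin s → 𝓞 K} : reduction I s y = 0 ↔ ∀ i, y i ∈ I :=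
  funext_iff.trans (forall_congr' fun _ => Ideal.Quotient.eq_zero_iff_mem)

theorem torsion_smul_injective {𝒞 : Set (Submodule (𝓞 K ⧸ I) (Fin s → 𝓞 K ⧸ I))}
    (h𝒞 : 𝒞.PairwiseDisjoint id) {y : 𝒞 → Fin s → 𝓞 K}
    (hy : ∀ C, reduction I s (y C) ∈ C.1) (hy0 : ∀ C, reduction I s (y C) ≠ 0) :
    Function.Injective fun t : 𝒞 × Units.torsion K => ((t.2 : (𝓞 K)ˣ) : 𝓞 K) • y t.1 := by
  rintro ⟨C, u⟩ ⟨D, v⟩ (h : ((u : (𝓞 K)ˣ) : 𝓞 K) • y C = ((v : (𝓞 K)ˣ) : 𝓞 K) • y D)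
  have hne : reduction I s (((u : (𝓞 K)ˣ) : 𝓞 K) • y C) ≠ 0 := by
    rw [reduction_smul]
    exact (((u : (𝓞 K)ˣ).isUnit.map (Ideal.Quotient.mk I)).smul_eq_zero).not.2 (hy0 C)
  have hmem (C : 𝒞) (u : (𝓞 K)ˣ) : reduction I s ((u : 𝓞 K) • y C) ∈ C.1 :=
    reduction_smul (I := I) (u : 𝓞 K) (y C) ▸ C.1.smul_mem _ (hy C)
  obtain rfl : C = D := by
    by_contra hCD
    exact hne <| Submodule.disjoint_def.1 (h𝒞 C.2 D.2 (Subtype.coe_ne_coe.2 hCD)) _ (hmem C u)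
      (h ▸ hmem D v)
  obtain ⟨i, hi⟩ := Function.ne_iff.1 fun h0 : y C = 0 => hy0 C (h0 ▸ map_zero _)
  exact Prod.ext rfl (Subtype.ext (Units.ext (mul_right_cancel₀ hi (congrFun h i))))

variable [NumberField K] {C : Submodule (𝓞 K ⧸ I) (Fin s → 𝓞 K ⧸ I)}

theorem mem_codeLattice {x : Ambient K s} :
    x ∈ codeLattice I C ↔ ∃ y, reduction I s y ∈ C ∧ embIntegers K s y = x :=
  Iff.rfl

theorem codeLattice_le_intLattice : codeLattice I C ≤ intLattice K s :=
  fun _ ⟨y, _, hy⟩ => ⟨y, hy⟩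

theorem codeLattice_injective : Function.Injective
    (codeLattice I : Submodule (𝓞 K ⧸ I) (Fin s → 𝓞 K ⧸ I) → Submodule ℤ (Ambient K s)) := by
  intro C D h
  exact Submodule.toAddSubgroup_injective <| AddSubgroup.comap_injective reduction_surjective <|
    AddSubgroup.map_injective (embIntegers_injective s) <| AddSubgroup.toIntSubmodule.injective h

theorem isLattice_codeLattice (hI : I ≠ ⊥) : IsLattice (codeLattice I C) := by
  refine isLattice_of_le_of_smul_mem codeLattice_le_intLattice
    (Int.natCast_ne_zero.2 (Ideal.absNorm_eq_zero_iff.not.2 hI)) ?_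
  rintro _ ⟨y, rfl⟩
  refine mem_codeLattice.2 ⟨(Ideal.absNorm I : ℤ) • y, ?_, map_zsmul _ _ _⟩
  have reduction_smul_eq_zero : reduction I s ((Ideal.absNorm I : ℤ) • y) = 0 :=
    reduction_eq_zero.2 fun i => by
      simpa using I.mul_mem_right (y i) (Ideal.absNorm_mem I)
  exact reduction_smul_eq_zero ▸ C.zero_mem

theorem relIndex_codeLattice :
    (codeLattice I C).toAddSubgroup.relIndex (intLattice K s).toAddSubgroup =
      C.toAddSubgroup.index := by
  have h := AddSubgroup.relIndex_map_map_of_injective (C.toAddSubgroup.comap (reduction I s)) ⊤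
    (embIntegers_injective s)
  rwa [AddSubgroup.relIndex_top_right, ← AddMonoidHom.range_eq_map,
    AddSubgroup.index_comap_of_surjective _ reduction_surjective] at h

theorem covolume_codeLattice (hI : I ≠ ⊥) :
    ZLattice.covolume (codeLattice I C) =
      C.toAddSubgroup.index * ZLattice.covolume (intLattice K s) := by
  obtain ⟨_, _⟩ := isLattice_codeLattice (C := C) hI
  rw [← relIndex_codeLattice, ← div_eq_iff (ZLattice.covolume_ne_zero _ _)]
  exact ZLattice.covolume_div_covolume_eq_relIndex' _ _ codeLattice_le_intLattice

theorem card_mul_torsionOrder_mul_covolume_le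
    {𝒞 : Finset (Submodule (𝓞 K ⧸ I) (Fin s → 𝓞 K ⧸ I))}
    (h𝒞 : (𝒞 : Set (Submodule (𝓞 K ⧸ I) (Fin s → 𝓞 K ⧸ I))).PairwiseDisjoint id) {r ρ : ℝ}
    (hρ : ∀ y, ∃ x ∈ intLattice K s, ‖y - x‖ ≤ ρ)
    (hI : ∀ y : Fin s → 𝓞 K, (∀ i, y i ∈ I) → y ≠ 0 → r < ‖embIntegers K s y‖)
    (hr : ∀ C ∈ 𝒞, ∃ x ∈ codeLattice I C, x ≠ 0 ∧ ‖x‖ ≤ r) :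
    (𝒞.card : ℝ) * Units.torsionOrder K * ZLattice.covolume (intLattice K s) ≤
      (volume : Measure (Ambient K s)).real (Metric.closedBall 0 (r + ρ)) := by
  have short (C : 𝒞) : ∃ y : Fin s → 𝓞 K, reduction I s y ∈ C.1 ∧ reduction I s y ≠ 0 ∧
      ‖embIntegers K s y‖ ≤ r := by
    obtain ⟨_, ⟨y, hy, rfl⟩, hy0, hyr⟩ := hr C C.2
    refine ⟨y, hy, fun h => ?_, hyr⟩
    exact (hI y (reduction_eq_zero.1 h) fun h0 => hy0 (h0 ▸ map_zero _)).not_ge hyr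
  choose y hyC hy0 hyr using short
  have := Fintype.ofFinite (Units.torsion K)
  let f : 𝒞 × Units.torsion K ↪ intLattice K s :=
    ⟨fun t => ⟨embIntegers K s (((t.2 : (𝓞 K)ˣ) : 𝓞 K) • y t.1), embIntegers_mem_intLattice _⟩,
      fun _ _ h => torsion_smul_injective h𝒞 hyC hy0
        (embIntegers_injective s (congrArg Subtype.val h))⟩
  have h := card_mul_covolume_le volume (intLattice K s) (r := r) hρ (Finset.univ.map f) (by
    intro x hx
    obtain ⟨⟨C, u⟩, -, rfl⟩ := Finset.mem_map.1 hx
    exact (norm_embIntegers_torsion_smul u (y C)).le.trans (hyr C))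
  rwa [Finset.card_map, Finset.card_univ, Fintype.card_prod, Fintype.card_coe,
    ← Nat.card_eq_fintype_card, Nat.cast_mul] at h

end ConstructionA

section LineFamily

variable {K : Type*} [Field K] [NumberField K] (𝔓 : Ideal (𝓞 K)) [𝔓.IsMaximal]

theorem ne_bot_of_isMaximal : 𝔓 ≠ ⊥ :=
  Ring.ne_bot_of_isMaximal_of_not_isField ‹_› (RingOfIntegers.not_isField K)

theorem ncard_lines : {C : Submodule (𝓞 K ⧸ 𝔓) (Fin 2 → 𝓞 K ⧸ 𝔓) |
    finrank (𝓞 K ⧸ 𝔓) C = 1}.ncard = Ideal.absNorm 𝔓 + 1 := by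
  let _ := Ideal.Quotient.field 𝔓
  have := Ideal.finiteQuotientOfFreeOfNeBot 𝔓 (ne_bot_of_isMaximal 𝔓)
  exact ncard_submodule_finrank_eq_one (Module.finrank_fin_fun _)

theorem ncard_lineFamily : (lineFamily 𝔓).ncard = Ideal.absNorm 𝔓 + 1 := by
  have lineFamily_eq_image : lineFamily 𝔓 = codeLattice 𝔓 ''
      {C : Submodule (𝓞 K ⧸ 𝔓) (Fin 2 → 𝓞 K ⧸ 𝔓) | finrank (𝓞 K ⧸ 𝔓) C = 1} :=
    Set.ext fun Λ => exists_congr fun C => and_congr_right fun _ => eq_comm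
  rw [lineFamily_eq_image, Set.ncard_image_of_injective _ codeLattice_injective, ncard_lines]

theorem isLattice_of_mem_lineFamily {Λ : Submodule ℤ (Ambient K 2)} (hΛ : Λ ∈ lineFamily 𝔓) :
    IsLattice Λ := by
  obtain ⟨C, -, rfl⟩ := hΛ
  exact isLattice_codeLattice (ne_bot_of_isMaximal 𝔓)

theorem covolume_of_mem_lineFamily {Λ : Submodule ℤ (Ambient K 2)} (hΛ : Λ ∈ lineFamily 𝔓) :
    ZLattice.covolume Λ = Ideal.absNorm 𝔓 * ZLattice.covolume (intLattice K 2) := by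
  obtain ⟨C, hC, rfl⟩ := hΛ
  let _ := Ideal.Quotient.field 𝔓
  have index_eq : C.toAddSubgroup.index = Ideal.absNorm 𝔓 := by
    have h := index_toAddSubgroup C
    rwa [hC, Module.finrank_fin_fun, pow_one] at h
  rw [covolume_codeLattice (ne_bot_of_isMaximal 𝔓), index_eq]

theorem exists_mem_lineFamily_forall_lt_norm {r ρ : ℝ}
    (hρ : ∀ y, ∃ x ∈ intLattice K 2, ‖y - x‖ ≤ ρ)
    (hr : (r ^ 2) ^ finrank ℚ K < (finrank ℚ K : ℝ) ^ finrank ℚ K * (Ideal.absNorm 𝔓 : ℝ) ^ 2)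
    (hvol : (volume : Measure (Ambient K 2)).real (Metric.closedBall 0 (r + ρ)) <
      (Ideal.absNorm 𝔓 + 1) * Units.torsionOrder K * ZLattice.covolume (intLattice K 2)) :
    ∃ Λ ∈ lineFamily 𝔓, ∀ x ∈ Λ, x ≠ 0 → r < ‖x‖ := by
  by_contra! hshort
  let _ := Ideal.Quotient.field 𝔓
  have hfin : {C : Submodule (𝓞 K ⧸ 𝔓) (Fin 2 → 𝓞 K ⧸ 𝔓) | finrank (𝓞 K ⧸ 𝔓) C = 1}.Finite :=
    Set.finite_of_ncard_ne_zero (by rw [ncard_lines]; exact Nat.succ_ne_zero _)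
  have h := card_mul_torsionOrder_mul_covolume_le (𝒞 := hfin.toFinset) (r := r)
    (by
      rw [hfin.coe_toFinset]
      exact pairwiseDisjoint_submodule_finrank_eq_one)
    hρ
    (fun y hy hy0 => lt_of_pow_lt_pow_left₀ 2 (norm_nonneg _) <|
      lt_of_pow_lt_pow_left₀ _ (sq_nonneg _) <|
        hr.trans_le (absNorm_sq_le_norm_embIntegers_pow hy hy0))
    (fun C hC => hshort _ ⟨C, hfin.mem_toFinset.1 hC, rfl⟩)
  rw [← Set.ncard_eq_toFinset_card _ hfin, ncard_lines, Nat.cast_add_one] at h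
  exact h.not_gt hvol

theorem exists_mem_lineFamily_le_density {r ρ : ℝ}
    (hρ : ∀ y, ∃ x ∈ intLattice K 2, ‖y - x‖ ≤ ρ)
    (hr : (r ^ 2) ^ finrank ℚ K < (finrank ℚ K : ℝ) ^ finrank ℚ K * (Ideal.absNorm 𝔓 : ℝ) ^ 2)
    (hvol : (volume : Measure (Ambient K 2)).real (Metric.closedBall 0 (r + ρ)) <
      (Ideal.absNorm 𝔓 + 1) * Units.torsionOrder K * ZLattice.covolume (intLattice K 2)) :
    ∃ Λ ∈ lineFamily 𝔓, (volume : Measure (Ambient K 2)).real (Metric.closedBall 0 r) /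
      (2 ^ (2 * finrank ℚ K) * (Ideal.absNorm 𝔓 * ZLattice.covolume (intLattice K 2))) ≤
        density Λ := by
  obtain ⟨Λ, hΛ, hlong⟩ := exists_mem_lineFamily_forall_lt_norm 𝔓 hρ hr hvol
  obtain ⟨_, _⟩ := isLattice_of_mem_lineFamily 𝔓 hΛ
  refine ⟨Λ, hΛ, ?_⟩
  rw [← covolume_of_mem_lineFamily 𝔓 hΛ, ← finrank_ambient]
  exact le_density fun x hx hx0 => (hlong x hx hx0).le

end LineFamily

section Radius

theorem one_sub_mul_div_mul_pow_le_sub_pow {R ρ : ℝ} (hR : 0 < R) (hρ : ρ ≤ 2 * R) (k : ℕ) :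
    (1 - k * (ρ / R)) * R ^ k ≤ (R - ρ) ^ k := by
  have bernoulli := one_add_mul_le_pow (a := -(ρ / R))
    (by rwa [neg_le_neg_iff, div_le_iff₀ hR]) k
  calc (1 - k * (ρ / R)) * R ^ k ≤ (1 + -(ρ / R)) ^ k * R ^ k := by
        gcongr
        linarith
    _ = (R - ρ) ^ k := by
        rw [← mul_pow]
        congr 1
        field_simp
        ring

-- In the application `n = [K : ℚ]`, `t ^ n = |𝓞 K ⧸ 𝔓|` and `κ = Vol(Λ₀) / Vol(B(1))`, so a ball of
-- radius `R` with `R ^ (2 * n) = m * t ^ n * κ` has volume `m * |𝓞 K ⧸ 𝔓| * Vol(Λ₀)`.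
variable {n m : ℕ} {t κ ε : ℝ}

theorem le_root_of_pow_eq (hn : 0 < n) (hnm : n ≤ m) (hε₀ : 0 < ε)
    (ht : (n : ℝ) ^ 2 * m ≤ (ε / 8) ^ 2 * t) (hκ : (n / 4 : ℝ) ^ n ≤ κ) {R : ℝ} (hR₀ : 0 ≤ R)
    (hR : R ^ (2 * n) = m * t ^ n * κ) : 4 * n ^ 2 / ε ≤ R := by
  have hn₁ : (1 : ℝ) ≤ n := by exact_mod_cast hn
  have hnm' : (n : ℝ) ≤ m := by exact_mod_cast hnm
  have ht' : 64 * (n : ℝ) ^ 3 / ε ^ 2 ≤ t := by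
    rw [div_le_iff₀ (by positivity)]
    nlinarith [mul_le_mul_of_nonneg_left hnm' (sq_nonneg (n : ℝ))]
  have ht₀ : 0 ≤ t := le_trans (by positivity) ht'
  have hpow : (t * (n / 4)) ^ n ≤ (R ^ 2) ^ n := by
    calc (t * (n / 4)) ^ n = 1 * t ^ n * (n / 4 : ℝ) ^ n := by ring
      _ ≤ m * t ^ n * κ := by
        gcongr
        exact hn₁.trans hnm'
      _ = (R ^ 2) ^ n := by rw [← hR, pow_mul]
  have hsq : t * (n / 4) ≤ R ^ 2 := le_of_pow_le_pow_left₀ hn.ne' (sq_nonneg R) hpow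
  refine le_of_sq_le_sq ?_ hR₀
  calc (4 * (n : ℝ) ^ 2 / ε) ^ 2 = 64 * (n : ℝ) ^ 3 / ε ^ 2 * (n / 4) := by ring
    _ ≤ t * (n / 4) := by gcongr
    _ ≤ R ^ 2 := hsq

theorem mul_pow_mul_le_of_mul_le (hn : 0 < n) (ht : (n * m : ℝ) ≤ t) (hκ : κ ≤ n ^ (2 * n)) :
    m * t ^ n * κ ≤ n ^ n * (t ^ n) ^ 2 := by
  have ht₀ : 0 ≤ t := le_trans (by positivity) ht
  have hm : (m : ℝ) ≤ m ^ n := by exact_mod_cast Nat.le_self_pow hn.ne' m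
  calc m * t ^ n * κ ≤ m * t ^ n * n ^ (2 * n) := by gcongr
    _ ≤ m ^ n * t ^ n * n ^ (2 * n) := by gcongr
    _ = n ^ n * ((n * m) ^ n * t ^ n) := by ring
    _ ≤ n ^ n * (t ^ n * t ^ n) := by gcongr
    _ = n ^ n * (t ^ n) ^ 2 := by ring

theorem exists_radius (hn : 0 < n) (hnm : n ≤ m) (hε₀ : 0 < ε) (hε₁ : ε < 1)
    (ht : (n : ℝ) ^ 2 * m ≤ (ε / 8) ^ 2 * t) (hκ₁ : (n / 4 : ℝ) ^ n ≤ κ)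
    (hκ₂ : κ ≤ n ^ (2 * n)) :
    ∃ r : ℝ, 0 ≤ r ∧ (r ^ 2) ^ n < n ^ n * (t ^ n) ^ 2 ∧
      (r + n) ^ (2 * n) ≤ m * t ^ n * κ ∧ (1 - ε) * (m * t ^ n * κ) < r ^ (2 * n) := by
  have hn₁ : (1 : ℝ) ≤ n := by exact_mod_cast hn
  have hm₀ : (0 : ℝ) < m := by exact_mod_cast hn.trans_le hnm
  have ht₀ : 0 < t := pos_of_mul_pos_right (lt_of_lt_of_le (by positivity) ht) (sq_nonneg _)
  have hκ₀ : 0 < κ := lt_of_lt_of_le (by positivity) hκ₁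
  have hnmt : (n * m : ℝ) ≤ t := by
    calc (n * m : ℝ) ≤ n ^ 2 * m := by
          gcongr
          exact le_self_pow₀ hn₁ two_ne_zero
      _ ≤ (ε / 8) ^ 2 * t := ht
      _ ≤ t := mul_le_of_le_one_left ht₀.le (pow_le_one₀ (by positivity) (by linarith))
  set R : ℝ := (m * t ^ n * κ) ^ (((2 * n : ℕ) : ℝ)⁻¹)
  have hR : R ^ (2 * n) = m * t ^ n * κ := Real.rpow_inv_natCast_pow (by positivity) (by positivity)
  have hRε : 4 * n ^ 2 / ε ≤ R := le_root_of_pow_eq hn hnm hε₀ ht hκ₁ (by positivity) hR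
  have hεR : 4 * n ^ 2 ≤ ε * R := (div_le_iff₀' hε₀).1 hRε
  have hR₀ : 0 < R := lt_of_lt_of_le (by positivity) hRε
  have hnR : (n : ℝ) ≤ R := by nlinarith
  have hrR : (R - n) ^ (2 * n) < R ^ (2 * n) :=
    pow_lt_pow_left₀ (by linarith) (by linarith) (by positivity)
  refine ⟨R - n, sub_nonneg.2 hnR, ?_, ?_, ?_⟩
  · rw [← pow_mul]
    exact (hrR.trans_eq hR).trans_le (mul_pow_mul_le_of_mul_le hn hnmt hκ₂)
  · rw [sub_add_cancel, hR]
  · rw [← hR]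
    refine lt_of_lt_of_le ?_ (one_sub_mul_div_mul_pow_le_sub_pow hR₀ (by linarith) (2 * n))
    have relative_error : ((2 * n : ℕ) : ℝ) * (n / R) < ε := by
      rw [← mul_div_assoc, div_lt_iff₀ hR₀]
      push_cast
      nlinarith
    gcongr

end Radius

section Density

variable {K : Type*} [Field K] [NumberField K]

theorem pow_mul_volume_ball_le_covolume_intLattice :
    (finrank ℚ K / 4 : ℝ) ^ finrank ℚ K * (volume : Measure (Ambient K 2)).real (Metric.ball 0 1) ≤
      ZLattice.covolume (intLattice K 2) := by
  have minkowski := measure_ball_le_covolume_mul_two_pow volume (intLattice K 2)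
    (r := √(finrank ℚ K)) fun x hx hx0 =>
      Real.sqrt_le_iff.2 ⟨norm_nonneg x, finrank_le_norm_sq_of_mem_intLattice hx hx0⟩
  rw [← Measure.addHaar_real_closedBall_eq_addHaar_real_ball,
    Measure.addHaar_real_closedBall _ _ (Real.sqrt_nonneg _), finrank_ambient, pow_mul, pow_mul,
    Real.sq_sqrt (Nat.cast_nonneg _)] at minkowski
  rw [div_pow, div_mul_eq_mul_div, div_le_iff₀ (by positivity)]
  convert! minkowski using 3
  norm_num

theorem covolume_intLattice_le {s : ℕ} {ρ : ℝ}
    (hρ : ∀ y, ∃ x ∈ intLattice K s, ‖y - x‖ ≤ ρ) :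
    ZLattice.covolume (intLattice K s) ≤
      ρ ^ (s * finrank ℚ K) * (volume : Measure (Ambient K s)).real (Metric.ball 0 1) := by
  obtain ⟨x, -, hx⟩ := hρ 0
  have h := card_mul_covolume_le volume (intLattice K s) hρ {0} (r := 0) (by simp)
  rwa [Finset.card_singleton, Nat.cast_one, one_mul, zero_add,
    Measure.addHaar_real_closedBall _ _ ((norm_nonneg _).trans hx), finrank_ambient] at h

theorem exists_mem_lineFamily_lt_density (𝔓 : Ideal (𝓞 K)) [𝔓.IsMaximal] {m : ℕ} {ε : ℝ}
    (hnm : finrank ℚ K ≤ m) (hmw : m ≤ Units.torsionOrder K)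
    (hρ : ∀ y, ∃ x ∈ intLattice K 2, ‖y - x‖ ≤ finrank ℚ K) (hε₀ : 0 < ε) (hε₁ : ε < 1)
    (hq : (finrank ℚ K : ℝ) ^ 2 * m ≤
      (ε / 8) ^ 2 * (Ideal.absNorm 𝔓 : ℝ) ^ (1 / (finrank ℚ K : ℝ))) :
    ∃ Λ ∈ lineFamily 𝔓, (1 - ε) * m / 2 ^ (2 * finrank ℚ K) < density Λ := by
  set n := finrank ℚ K
  set q : ℝ := (Ideal.absNorm 𝔓 : ℝ) with hqdef
  set V := ZLattice.covolume (intLattice K 2)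
  set B := (volume : Measure (Ambient K 2)).real (Metric.ball 0 1)
  have hn : 0 < n := finrank_pos
  have hm : (0 : ℝ) < m := by exact_mod_cast hn.trans_le hnm
  have hq₀ : 0 < q := Nat.cast_pos.2 <| Nat.pos_of_ne_zero <|
    Ideal.absNorm_eq_zero_iff.not.2 (ne_bot_of_isMaximal 𝔓)
  have hV : 0 < V := ZLattice.covolume_pos _ _
  have hB : 0 < B := ENNReal.toReal_pos (Metric.measure_ball_pos _ _ one_pos).ne'
    measure_ball_lt_top.ne
  have hroot : (q ^ (1 / (n : ℝ))) ^ n = q := by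
    rw [one_div, Real.rpow_inv_natCast_pow hq₀.le hn.ne']
  obtain ⟨r, hr₀, hrq, hrV, hr⟩ := exists_radius (κ := V / B) hn hnm hε₀ hε₁ hq
    ((le_div_iff₀ hB).2 pow_mul_volume_ball_le_covolume_intLattice)
    ((div_le_iff₀ hB).2 (covolume_intLattice_le hρ))
  rw [hroot, ← mul_div_assoc] at hrV hr
  rw [hroot] at hrq
  have hvol : (volume : Measure (Ambient K 2)).real (Metric.closedBall 0 (r + n)) <
      (q + 1) * Units.torsionOrder K * V := by
    calc (volume : Measure (Ambient K 2)).real (Metric.closedBall 0 (r + n))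
        = (r + n) ^ (2 * n) * B := by
          rw [Measure.addHaar_real_closedBall _ _ (by positivity), finrank_ambient]
      _ ≤ m * q * V := (le_div_iff₀ hB).1 hrV
      _ < m * (q + 1) * V := by
          gcongr
          exact lt_add_one q
      _ ≤ (q + 1) * Units.torsionOrder K * V := by
          rw [mul_comm (m : ℝ)]
          gcongr
  obtain ⟨Λ, hΛ, hdensity⟩ := exists_mem_lineFamily_le_density 𝔓 hρ hrq hvol
  refine ⟨Λ, hΛ, lt_of_lt_of_le ?_ hdensity⟩
  rw [Measure.addHaar_real_closedBall _ _ hr₀, finrank_ambient, ← hqdef,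
    div_lt_div_iff₀ (by positivity) (by positivity)]
  rw [← mul_div_assoc, div_lt_iff₀ hB] at hr
  calc (1 - ε) * m * (2 ^ (2 * n) * (q * V)) = (1 - ε) * (m * q * V) * 2 ^ (2 * n) := by ring
    _ < r ^ (2 * n) * B * 2 ^ (2 * n) := by gcongr

theorem ne_bot_of_le_mul_absNorm_rpow {I : Ideal (𝓞 K)} {x c a : ℝ} (hx : 0 < x) (ha : a ≠ 0)
    (h : x ≤ c * (Ideal.absNorm I : ℝ) ^ a) : I ≠ ⊥ := by
  rintro rfl
  rw [Ideal.absNorm_bot, Nat.cast_zero, Real.zero_rpow ha, mul_zero] at h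
  exact h.not_gt hx

end Density

section Cyclotomic

variable (m : ℕ) [NeZero m]

theorem isCyclotomicExtension_cyclotomicField_rat :
    IsCyclotomicExtension {m} ℚ (CyclotomicField m ℚ) := by
  -- Instance search equips `CyclotomicField m ℚ` with the `ℚ`-algebra structure of a field of
  -- characteristic zero, whereas the library instance is about the one of a splitting field.
  rw [show (DivisionRing.toRatAlgebra : Algebra ℚ (CyclotomicField m ℚ)) =
    CyclotomicField.algebra m ℚ from Subsingleton.elim _ _]
  exact CyclotomicField.isCyclotomicExtension m ℚ

theorem le_torsionOrder_of_isCyclotomicExtension (K : Type*) [Field K] [NumberField K]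
    [IsCyclotomicExtension {m} ℚ K] : m ≤ Units.torsionOrder K :=
  Nat.le_of_dvd (Units.torsionOrder_pos K) <|
    Units.dvd_torsionOrder_of_isPrimitiveRoot (IsCyclotomicExtension.zeta_spec m ℚ K)

theorem exists_mem_intLattice_norm_sub_le_finrank {K : Type*} [Field K] [NumberField K]
    [IsCyclotomicExtension {m} ℚ K] (y : Ambient K 2) :
    ∃ x ∈ intLattice K 2, ‖y - x‖ ≤ finrank ℚ K := by
  have hζ := IsCyclotomicExtension.zeta_spec m ℚ K
  let b := hζ.powerBasis ℚ
  have gen_eq : b.gen = IsCyclotomicExtension.zeta m ℚ K := hζ.powerBasis_gen ℚ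
  let v : Fin b.dim → 𝓞 K := fun i => hζ.toInteger ^ (i : ℕ)
  have hv : (fun i => (v i : K)) = b.basis := by
    ext i
    rw [b.basis_eq_pow, gen_eq]
    rfl
  have norm_sq_eq (i : Fin b.dim) : ‖embK K (v i)‖ ^ 2 = finrank ℚ K := by
    refine norm_embK_sq_of_pow_eq_one (NeZero.ne m) ?_
    rw [congrFun hv i, b.basis_eq_pow, gen_eq, pow_right_comm, hζ.pow_eq_one, one_pow]
  obtain ⟨x, hx, hxy⟩ := exists_mem_intLattice_norm_sub_sq_le (hv ▸ b.basis.span_eq) y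
  refine ⟨x, hx, le_of_sq_le_sq (hxy.trans ?_) (Nat.cast_nonneg _)⟩
  simp only [norm_sq_eq, Finset.sum_const, Finset.card_univ, Fintype.card_fin, nsmul_eq_mul,
    ← b.finrank]
  push_cast
  nlinarith [sq_nonneg (finrank ℚ K : ℝ)]

end Cyclotomic

end CyclotomicLattices

open CyclotomicLattices in
theorem mainTheorem2_general (𝔓 : (m : ℕ) → Ideal (𝓞 (CyclotomicField m ℚ)))
    (hprime : ∀ m : ℕ, 1 ≤ m → (𝔓 m).IsPrime)
    (hq : (fun m : ℕ => (Nat.totient m : ℝ) ^ 2 * (m : ℝ)) =o[atTop]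
      (fun m : ℕ => (Ideal.absNorm (𝔓 m) : ℝ) ^ (1 / (Nat.totient m : ℝ))))
    (ε : ℝ) (hε₀ : 0 < ε) (hε₁ : ε < 1) :
    ∀ᶠ m : ℕ in atTop,
      finrank ℝ (Ambient (CyclotomicField m ℚ) 2) = 2 * Nat.totient m ∧
      (lineFamily (𝔓 m)).ncard = Ideal.absNorm (𝔓 m) + 1 ∧
      (∀ Λ ∈ lineFamily (𝔓 m), IsLattice Λ) ∧
      ∃ Λ ∈ lineFamily (𝔓 m), density Λ > (1 - ε) * (m : ℝ) / 2 ^ (2 * Nat.totient m) := by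
  filter_upwards [hq.def (c := (ε / 8) ^ 2) (by positivity), eventually_ge_atTop 1] with m hqm hm
  have : NeZero m := ⟨Nat.one_le_iff_ne_zero.1 hm⟩
  have := isCyclotomicExtension_cyclotomicField_rat m
  have hn : finrank ℚ (CyclotomicField m ℚ) = Nat.totient m := IsCyclotomicExtension.Rat.finrank m _
  have hφ : 0 < Nat.totient m := Nat.totient_pos.2 hm
  rw [Real.norm_of_nonneg (by positivity), Real.norm_of_nonneg (by positivity), ← hn] at hqm
  rw [← hn] at hφ ⊢
  have : (𝔓 m).IsMaximal := (hprime m hm).isMaximal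
    (ne_bot_of_le_mul_absNorm_rpow (by positivity) (by positivity) hqm)
  exact ⟨finrank_ambient _ 2, ncard_lineFamily _, fun _ => isLattice_of_mem_lineFamily _,
    exists_mem_lineFamily_lt_density _ (hn.trans_le (Nat.totient_le m))
      (le_torsionOrder_of_isCyclotomicExtension m _)
      (exists_mem_intLattice_norm_sub_le_finrank m) hε₀ hε₁ hqm⟩

theorem mainTheorem2
    (p : ℕ → ℕ) (𝔓 : (m : ℕ) → Ideal (𝓞 (CyclotomicField m ℚ)))
    (hp : ∀ m : ℕ, 1 ≤ m → (p m).Prime)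
    (hpm : ∀ m : ℕ, 1 ≤ m → ¬ p m ∣ m)
    (hprime : ∀ m : ℕ, 1 ≤ m → (𝔓 m).IsPrime)
    (hover : ∀ m : ℕ, 1 ≤ m → (𝔓 m).LiesOver (Ideal.span {(p m : ℤ)}))
    (hq : (fun m : ℕ => (Nat.totient m : ℝ) ^ 2 * (m : ℝ)) =o[atTop]
      (fun m : ℕ => (Ideal.absNorm (𝔓 m) : ℝ) ^ (1 / (Nat.totient m : ℝ))))
    (ε : ℝ) (hε₀ : 0 < ε) (hε₁ : ε < 1) :
    ∀ᶠ m : ℕ in atTop,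
      finrank ℝ (CyclotomicLattices.Ambient (CyclotomicField m ℚ) 2) = 2 * Nat.totient m ∧
      (CyclotomicLattices.lineFamily (𝔓 m)).ncard = Ideal.absNorm (𝔓 m) + 1 ∧
      (∀ Λ ∈ CyclotomicLattices.lineFamily (𝔓 m), CyclotomicLattices.IsLattice Λ) ∧
      ∃ Λ ∈ CyclotomicLattices.lineFamily (𝔓 m),
        CyclotomicLattices.density Λ > (1 - ε) * (m : ℝ) / 2 ^ (2 * Nat.totient m) :=
  mainTheorem2_general 𝔓 hprime hq ε hε₀ hε₁
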